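/- All Banach spaces are real; sequences are indexed by $\mathbb N=\{0,1,2,\dots\}$. For a finite set $s\subseteq\mathbb N$ let $s(1)<\dots<s(|s|)$ be its elements; $s\sqsubseteq A$ means that $s$ is an initial segment of $A$. For a family $\mathcal F$ of finite subsets of $\mathbb N$, $m,n\in\mathbb N$ and an infinite $M\subseteq\mathbb N$ put $\mathcal F/m=\{s\in\mathcal F:\ m<a\text{ for all }a\in s\}$, $\mathcal F_{\{n\}}=\{s:\ n<a\text{ for all }a\in s,\ \{n\}\cup s\in\mathcal F\}$, $\mathcal F\upharpoonright_M=\{s\in\mathcal F: s\subseteq M\}$ and $M/n=\{a\in M:a>n\}$; $[\mathbb N]^k$ is the family of $k$-element subsets of $\mathbb N$. A family $\mathcal B$ is a barrier if every infinite $M\subseteq\mathbb N$ has an initial segment in $\mathcal B$ and no member of $\mathcal B$ is contained in a different member. $\mathcal F$ is $0$-uniform on $M$ if $\mathcal F=\{\emptyset\}$; it is $(\beta+1)$-uniform on $M$ if $\mathcal F_{\{n\}}$ is $\beta$-uniform on $M/n$ for every $n\in M$; for a countable limit ordinal $\alpha$ it is $\alpha$-uniform on $M$ if there are ordinals $\alpha_n<\alpha$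 $(n\in M)$, nondecreasing in $n$ with supremum $\alpha$, such that $\mathcal F_{\{n\}}$ is $\alpha_n$-uniform on $M/n$ for every $n\in M$. A $\xi$-uniform barrier is a barrier that is $\xi$-uniform on $\mathbb N$. A tuple $(s_i)_{i<n}$ of finite sets is plegma if $|s_0|\le\dots\le|s_{n-1}|$, $s_i(p)<s_j(p)$ whenever $i<j$ and $1\le p\le |s_i|$, and $s_i(p)<s_j(p+1)$ whenever $1\le p\le|s_i|$ and $p+1\le |s_j|$. An $\mathcal F\times\mathbb N$-matrix in a Banach space $X$ is a family $(x^i_s)_{s\in\mathcal F,\,i\in\mathbb N}$ of unit vectors of $X$. A normalized Schauder basis $(e_i)$ of a Banach space $E$ is an asymptotic model of this matrix (is generated by it) if there is a nonincreasing sequence $\varepsilon_m\to0$ such that, for all $n<m$, all plegma $(s_i)_{i<n}$ with $s_i\in\mathcal F/m$, and all $(a_i)_{i<n}\in[-1,1]^n$, $$\Bigl|\,\bigl\|\sum_{i<n}a_ie_i\bigr\|_E-\bigl\|\sum_{i<n}a_ix^i_{s_i}\bigr\|_X\Bigr|<\varepsilon_m .$$ $AM_\xi(X)$ denotes the class of all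 asymptotic models of $\mathcal B\times\mathbb N$-matrices in $X$, where $\mathcal B$ is a $\xi$-uniform barrier. If $(f_i)$ is a Schauder basis of $F$, an $\mathcal F\times\mathbb N$-matrix $(y^i_t)$ in $F$ is plegma block with respect to $(f_i)$ if each entry is a (nonzero) finite linear combination of the $f_i$, and for every $n$ there is an $m$ such that for every plegma $(t_i)_{i<n}$ with $t_i\in\mathcal F/m$ the vectors $y^0_{t_0},\dots,y^{n-1}_{t_{n-1}}$ have successive supports with respect to $(f_i)$. **Theorem.** Let $X$ be a Banach space, $k\ge1$ an integer and $\xi<\omega_1$ an ordinal. Let $(f_i)\in AM_\xi(X)$ be a basis of the Banach space $F$, let $M\subseteq\mathbb N$ be infinite, and let $(e_i)$, a normalized Schauder basis of a Banach space $E$, be an asymptotic model of an $([\mathbb N]^k\upharpoonright_M)\times\mathbb N$-matrix in $F$ that is plegma block with respect to $(f_i)$. Then $(e_i)\in AM_{\xi+k}(X)$. -/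

import Mathlib

open Filter Topology

namespace PlegmaModels

/-! ### Families of finite sets of natural numbers -/

/-- `s ⊑ A`: the finite set `s` is an initial segment of `A`. -/
def IsInitSegOf (s : Finset ℕ) (A : Set ℕ) : Prop :=
  (∀ b ∈ s, b ∈ A) ∧ ∀ b ∈ s, ∀ a ∈ A, a < b → a ∈ s

/-- `𝓕 / m`: the members of `𝓕` all of whose elements are greater than `m`
(the empty set, if it belongs to `𝓕`, is kept: its minimum is `+∞`). -/
def above (𝓕 : Set (Finset ℕ)) (m : ℕ) : Set (Finset ℕ) :=
  {s | s ∈ 𝓕 ∧ ∀ a ∈ s, m < a}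

/-- `𝓕_{n} = {s : n < s, {n} ∪ s ∈ 𝓕}`. -/
def derived (𝓕 : Set (Finset ℕ)) (n : ℕ) : Set (Finset ℕ) :=
  {s | (∀ a ∈ s, n < a) ∧ insert n s ∈ 𝓕}

/-- `𝓕 ↾ M`: the members of `𝓕` contained in `M`. -/
def restrict (𝓕 : Set (Finset ℕ)) (M : Set ℕ) : Set (Finset ℕ) :=
  {s | s ∈ 𝓕 ∧ (s : Set ℕ) ⊆ M}

/-- `[ℕ]^k`: the sets of natural numbers with exactly `k` elements. -/
def kSubsets (k : ℕ) : Set (Finset ℕ) :=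
  {s | s.card = k}

/-- Barriers on `ℕ`. -/
def IsBarrier (𝓑 : Set (Finset ℕ)) : Prop :=
  (∀ M : Set ℕ, M.Infinite → ∃ s ∈ 𝓑, IsInitSegOf s M) ∧
    ∀ s ∈ 𝓑, ∀ t ∈ 𝓑, s ≠ t → ¬ s ⊆ t ∧ ¬ t ⊆ s

/-- `IsUniformOn α M 𝓕`: the family `𝓕` is `α`-uniform on the infinite set `M`. In the limit
case the ordinals `a n`, `n ∈ M`, increase to `α` and stay below it. -/
inductive IsUniformOn : Ordinal.{0} → Set ℕ → Set (Finset ℕ) → Prop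
  | zero (M : Set ℕ) : IsUniformOn 0 M {∅}
  | succ (β : Ordinal.{0}) (M : Set ℕ) (𝓕 : Set (Finset ℕ))
      (h : ∀ n ∈ M, IsUniformOn β {m | m ∈ M ∧ n < m} (derived 𝓕 n)) :
      IsUniformOn (β + 1) M 𝓕
  | limit (α : Ordinal.{0}) (M : Set ℕ) (𝓕 : Set (Finset ℕ)) (a : ℕ → Ordinal.{0})
      (hα : Order.IsSuccLimit α) (hmono : MonotoneOn a M) (hlt : ∀ n ∈ M, a n < α)
      (hsup : ∀ β < α, ∃ n ∈ M, β < a n)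
      (h : ∀ n ∈ M, IsUniformOn (a n) {m | m ∈ M ∧ n < m} (derived 𝓕 n)) :
      IsUniformOn α M 𝓕

/-- `𝓑` is a `ξ`-uniform barrier on `ℕ`. -/
def IsUniformBarrier (ξ : Ordinal.{0}) (𝓑 : Set (Finset ℕ)) : Prop :=
  IsBarrier 𝓑 ∧ IsUniformOn ξ Set.univ 𝓑

/-- Plegma sequences: the cardinalities are nondecreasing, and whenever the elements involved
exist, `s i (p) < s j (p)` for `i < j` and `s i (p) < s j (p + 1)` for all `i, j`. Here `s i (p)`
is the element number `p` of `s i` in increasing order (counted from `0`). -/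
def IsPlegma {n : ℕ} (s : Fin n → Finset ℕ) : Prop :=
  (∀ i j : Fin n, i ≤ j → (s i).card ≤ (s j).card) ∧
  (∀ i j : Fin n, i < j → ∀ (p : ℕ) (hi : p < (s i).card) (hj : p < (s j).card),
    (s i).orderEmbOfFin rfl ⟨p, hi⟩ < (s j).orderEmbOfFin rfl ⟨p, hj⟩) ∧
  (∀ i j : Fin n, ∀ (p : ℕ) (hi : p < (s i).card) (hj : p + 1 < (s j).card),
    (s i).orderEmbOfFin rfl ⟨p, hi⟩ < (s j).orderEmbOfFin rfl ⟨p + 1, hj⟩)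

/-! ### Matrices of vectors and asymptotic models -/

section Matrices

variable {X E : Type*} [NormedAddCommGroup X] [NormedSpace ℝ X]
  [NormedAddCommGroup E] [NormedSpace ℝ E]

/-- `x` is an `𝓕 × ℕ`-matrix in the unit sphere of `X`, with entries `x i s`, `s ∈ 𝓕`, `i ∈ ℕ`
(the values `x i s` with `s ∉ 𝓕` are irrelevant). -/
def IsMatrix (𝓕 : Set (Finset ℕ)) (x : ℕ → Finset ℕ → X) : Prop :=
  ∀ i : ℕ, ∀ s ∈ 𝓕, ‖x i s‖ = 1

/-- The convergence by which an `𝓕 × ℕ`-matrix `x` generates the sequence `e`: for some null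
sequence `ε m`, decreasing, `‖∑ a i • x i (s i)‖` is within `ε m` of `‖∑ a i • e i‖` for all
`m > n`, all plegma `n`-tuples `s` in `𝓕 / m` and all coefficients in `[-1, 1]`. -/
def Generates (𝓕 : Set (Finset ℕ)) (x : ℕ → Finset ℕ → X) (e : ℕ → E) : Prop :=
  ∃ ε : ℕ → ℝ, Antitone ε ∧ Tendsto ε atTop (𝓝 0) ∧
    ∀ n m : ℕ, n < m → ∀ s : Fin n → Finset ℕ, (∀ i, s i ∈ above 𝓕 m) → IsPlegma s →
      ∀ a : Fin n → ℝ, (∀ i, a i ∈ Set.Icc (-1 : ℝ) 1) →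
        |‖∑ i : Fin n, a i • e i‖ - ‖∑ i : Fin n, a i • x i (s i)‖| < ε m

/-- The normalized Schauder basis `e` of `E` is an asymptotic model of the
`𝓕 × ℕ`-matrix `x` in `X`. -/
def IsAsymptoticModelOf (𝓕 : Set (Finset ℕ)) (x : ℕ → Finset ℕ → X)
    (e : SchauderBasis ℝ E) : Prop :=
  IsMatrix 𝓕 x ∧ (∀ i, ‖e i‖ = 1) ∧ Generates 𝓕 x e

variable (X E) in
/-- `AM ξ X E`: the asymptotic models of order `ξ` of `X` that are Schauder bases of `E`. -/
def AM (ξ : Ordinal.{0}) : Set (SchauderBasis ℝ E) :=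
  {e | ∃ 𝓑 : Set (Finset ℕ), IsUniformBarrier ξ 𝓑 ∧
    ∃ x : ℕ → Finset ℕ → X, IsAsymptoticModelOf 𝓑 x e}

/-- `u` is a block vector of the basis `f`: a nonzero finite linear combination. -/
def IsBlockVector (f : SchauderBasis ℝ E) (u : E) : Prop :=
  u ≠ 0 ∧ ∃ c : ℕ →₀ ℝ, u = Finsupp.linearCombination ℝ (f : ℕ → E) c

/-- `u 0, …, u (n - 1)` is a (finite) block subsequence of the basis `f`: nonzero finite linear
combinations with successive supports. -/
def IsBlockSequence (f : SchauderBasis ℝ E) {n : ℕ} (u : Fin n → E) : Prop :=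
  (∀ i, u i ≠ 0) ∧ ∃ c : Fin n → ℕ →₀ ℝ,
    (∀ i, u i = Finsupp.linearCombination ℝ (f : ℕ → E) (c i)) ∧
    ∀ i j, i < j → ∀ p ∈ (c i).support, ∀ q ∈ (c j).support, p < q

/-- Plegma block `𝓕 × ℕ`-matrices with respect to the Schauder basis `f`. -/
def IsPlegmaBlock (f : SchauderBasis ℝ E) (𝓕 : Set (Finset ℕ)) (y : ℕ → Finset ℕ → E) : Prop :=
  (∀ i : ℕ, ∀ t ∈ 𝓕, IsBlockVector f (y i t)) ∧
  ∀ n : ℕ, ∃ m : ℕ, ∀ t : Fin n → Finset ℕ, (∀ i, t i ∈ above 𝓕 m) → IsPlegma t →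
    IsBlockSequence f fun i : Fin n => y i (t i)

end Matrices

end PlegmaModels

namespace PlegmaModels

/-! ### Operations on uniform families -/

/-! A block vector is a finite combination of the `f j`, and each `f j` is imitated in `X` by an
entry of the matrix generating `f`. One finite set `r` should therefore index both choices: its
first `k` elements (the head), moved into `M`, select a block vector, and the remaining ones (the
tail), which form a member of a copy of the barrier `𝓑`, supply for each `j` a member of `𝓑` at
which row `j` is read. Such `r` form a uniform barrier of rank `ξ + k` by
`IsUniformBarrier.pullback` and `IsUniformBarrier.prepend`.

The norms agree approximately once the members of `𝓑` used for successive `j` are plegma and far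
enough out. Replacing each tail element `b` by `l (h b + j)`, with large gaps in `h`, interlaces
them. In a plegma tuple all heads lie below all tails, so the gaps can be fixed in advance according
to the number and size of the coefficients, which the heads control.

The obstacle is that a shifted tail need not belong to `𝓑`, and that cardinalities in a plegma tuple
may not decrease. `IsUniformBarrier.exists_isMonotoneAlong` removes it: on a sparse set, lowering a
member of `𝓑` pointwise yields a set with an initial segment in `𝓑`, because ranks of derived
families do not drop at later elements. `isPlegma_shifted` draws the consequence,
`exists_approximation` assembles the estimate, and normalizing the vectors adds a null error. -/

/-- The family of all finite sets whose image under `φ` belongs to `𝓕`. -/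
def pullback (φ : ℕ → ℕ) (𝓕 : Set (Finset ℕ)) : Set (Finset ℕ) :=
  {s | s.image φ ∈ 𝓕}

/-- The family of all unions `t ∪ u`, where `t` has `k` elements, `u ∈ 𝓕` and `t < u`. -/
def prepend (k : ℕ) (𝓕 : Set (Finset ℕ)) : Set (Finset ℕ) :=
  {s | ∃ t u, t.card = k ∧ u ∈ 𝓕 ∧ (∀ a ∈ t, ∀ b ∈ u, a < b) ∧ s = t ∪ u}

lemma infinite_above {M : Set ℕ} (hM : M.Infinite) (n : ℕ) : {m | m ∈ M ∧ n < m}.Infinite := by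
  refine Set.infinite_of_forall_exists_gt fun a => ?_
  obtain ⟨b, hb, hab⟩ := hM.exists_gt (max a n)
  exact ⟨b, ⟨hb, (le_max_right _ _).trans_lt hab⟩, (le_max_left _ _).trans_lt hab⟩

lemma derived_above (𝓕 : Set (Finset ℕ)) {m n : ℕ} (h : m < n) :
    derived (above 𝓕 m) n = derived 𝓕 n := by
  ext s
  simp only [derived, above, Set.mem_ofPred_eq, Finset.mem_insert, forall_eq_or_imp]
  exact ⟨fun ⟨h1, h2, _⟩ => ⟨h1, h2⟩, fun ⟨h1, h2⟩ => ⟨h1, h2, h, fun a ha => h.trans (h1 a ha)⟩⟩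

lemma derived_pullback {φ : ℕ → ℕ} (hφ : StrictMono φ) (𝓕 : Set (Finset ℕ)) (n : ℕ) :
    derived (pullback φ 𝓕) n = pullback φ (derived 𝓕 (φ n)) := by
  ext s
  simp [derived, pullback, Finset.image_insert, hφ.lt_iff_lt]

lemma IsUniformOn.nonempty {α : Ordinal.{0}} {M : Set ℕ} {𝓕 : Set (Finset ℕ)}
    (h : IsUniformOn α M 𝓕) : M.Infinite → 𝓕.Nonempty := by
  induction h with
  | zero M => exact fun _ => Set.singleton_nonempty _
  | succ β M 𝓕 h ih =>
    intro hM
    obtain ⟨n, hn⟩ := hM.nonempty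
    obtain ⟨s, hs⟩ := ih n hn (infinite_above hM n)
    exact ⟨_, hs.2⟩
  | limit α M 𝓕 a hα hmono hlt hsup h ih =>
    intro hM
    obtain ⟨n, hn⟩ := hM.nonempty
    obtain ⟨s, hs⟩ := ih n hn (infinite_above hM n)
    exact ⟨_, hs.2⟩

/-- In the limit case the ordinals of the derived families are cofinal along every tail. -/
lemma exists_gt_of_cofinal {α : Ordinal.{0}} {M : Set ℕ}
    {a : ℕ → Ordinal.{0}} (hlt : ∀ n ∈ M, a n < α) (hsup : ∀ β < α, ∃ n ∈ M, β < a n)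
    {β : Ordinal.{0}} (hβ : β < α) (m : ℕ) : ∃ n ∈ M, m < n ∧ β < a n := by
  induction m generalizing β with
  | zero =>
    by_cases h0 : 0 ∈ M
    -- Asking for a value above `a 0` as well excludes the index `0`; the inductive step excludes `m
    -- + 1` in the same way.
    · obtain ⟨n, hn, h⟩ := hsup (max β (a 0)) (max_lt hβ (hlt 0 h0))
      refine ⟨n, hn, Nat.pos_of_ne_zero ?_, (le_max_left _ _).trans_lt h⟩
      rintro rfl
      exact absurd ((le_max_right _ _).trans_lt h) (lt_irrefl _)
    · obtain ⟨n, hn, h⟩ := hsup β hβ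
      exact ⟨n, hn, Nat.pos_of_ne_zero fun h => h0 (h ▸ hn), h⟩
  | succ m ih =>
    by_cases h0 : m + 1 ∈ M
    · obtain ⟨n, hn, hmn, h⟩ := ih (max_lt hβ (hlt _ h0))
      refine ⟨n, hn, lt_of_le_of_ne hmn ?_, (le_max_left _ _).trans_lt h⟩
      rintro rfl
      exact absurd ((le_max_right _ _).trans_lt h) (lt_irrefl _)
    · obtain ⟨n, hn, hmn, h⟩ := ih hβ
      exact ⟨n, hn, lt_of_le_of_ne hmn fun h => h0 (h ▸ hn), h⟩

lemma IsUniformOn.above {α : Ordinal.{0}} {M : Set ℕ} {𝓕 : Set (Finset ℕ)}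
    (h : IsUniformOn α M 𝓕) (n : ℕ) : IsUniformOn α {m | m ∈ M ∧ n < m} (above 𝓕 n) := by
  have key : ∀ k, n < k → {m | m ∈ {m | m ∈ M ∧ n < m} ∧ k < m} = {m | m ∈ M ∧ k < m} := by
    intro k hk
    ext m
    simp only [Set.mem_ofPred_eq]
    exact ⟨fun h => ⟨h.1.1, h.2⟩, fun h => ⟨⟨h.1, hk.trans h.2⟩, h.2⟩⟩
  cases h with
  | zero M =>
    convert IsUniformOn.zero _
    ext s
    simp only [PlegmaModels.above, Set.mem_ofPred_eq, Set.mem_singleton_iff, and_iff_left_iff_imp]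
    rintro rfl
    simp
  | succ β M 𝓕 h =>
    refine IsUniformOn.succ _ _ _ fun k hk => ?_
    rw [derived_above _ hk.2, key k hk.2]
    exact h k hk.1
  | limit α M 𝓕 a hα hmono hlt hsup h =>
    refine IsUniformOn.limit _ _ _ a hα (hmono.mono fun _ h => h.1) (fun k hk => hlt k hk.1)
      (fun β hβ => ?_) fun k hk => ?_
    · obtain ⟨k, hk, hnk, h⟩ := exists_gt_of_cofinal hlt hsup hβ n
      exact ⟨k, ⟨hk, hnk⟩, h⟩
    · rw [derived_above _ hk.2, key k hk.2]
      exact h k hk.1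

lemma IsUniformOn.pullback {φ : ℕ → ℕ} (hφ : StrictMono φ) {α : Ordinal.{0}} {M : Set ℕ}
    {𝓕 : Set (Finset ℕ)} (h : IsUniformOn α M 𝓕) :
    ∀ M' : Set ℕ, M'.Infinite → Set.MapsTo φ M' M → IsUniformOn α M' (pullback φ 𝓕) := by
  induction h with
  | zero M =>
    intro M' _ _
    convert IsUniformOn.zero _
    ext s
    simp [PlegmaModels.pullback]
  | succ β M 𝓕 h ih =>
    intro M' hM' hmap
    refine IsUniformOn.succ _ _ _ fun n hn => ?_
    rw [derived_pullback hφ]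
    exact ih _ (hmap hn) _ (infinite_above hM' n) fun m hm => ⟨hmap hm.1, hφ hm.2⟩
  | limit α M 𝓕 a hα hmono hlt hsup h ih =>
    intro M' hM' hmap
    refine IsUniformOn.limit _ _ _ (a ∘ φ) hα
      (fun m hm n hn hmn => hmono (hmap hm) (hmap hn) (hφ.monotone hmn))
      (fun n hn => hlt _ (hmap hn)) (fun β hβ => ?_) fun n hn => ?_
    · obtain ⟨n, hn, h⟩ := hsup β hβ
      -- Cofinality survives on the smaller set because the ranks are monotone and `φ m ≥ m`.
      obtain ⟨m, hm, hnm⟩ := hM'.exists_gt n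
      exact ⟨m, hm, h.trans_le (hmono hn (hmap hm) (hnm.le.trans (hφ.id_le m)))⟩
    · rw [derived_pullback hφ]
      exact ih _ (hmap hn) _ (infinite_above hM' n) fun m hm => ⟨hmap hm.1, hφ hm.2⟩

lemma IsBarrier.eq_of_subset {𝓑 : Set (Finset ℕ)} (h : IsBarrier 𝓑) {s t : Finset ℕ}
    (hs : s ∈ 𝓑) (ht : t ∈ 𝓑) (hst : s ⊆ t) : s = t := by
  by_contra hne
  exact (h.2 s hs t ht hne).1 hst

lemma isBarrier_of_eq_of_subset {𝓑 : Set (Finset ℕ)}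
    (h1 : ∀ M : Set ℕ, M.Infinite → ∃ s ∈ 𝓑, IsInitSegOf s M)
    (h2 : ∀ s ∈ 𝓑, ∀ t ∈ 𝓑, s ⊆ t → s = t) : IsBarrier 𝓑 :=
  ⟨h1, fun s hs t ht hne => ⟨fun h => hne (h2 s hs t ht h), fun h => hne (h2 t ht s hs h).symm⟩⟩

lemma IsBarrier.pullback {φ : ℕ → ℕ} (hφ : StrictMono φ) {𝓑 : Set (Finset ℕ)}
    (h : IsBarrier 𝓑) : IsBarrier (pullback φ 𝓑) := by
  refine isBarrier_of_eq_of_subset (fun M hM => ?_) fun s hs t ht hst => ?_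
  · obtain ⟨s, hs, h1, h2⟩ := h.1 (φ '' M) (hM.image hφ.injective.injOn)
    have hs' : (s.preimage φ hφ.injective.injOn).image φ = s := by
      ext b
      simp only [Finset.mem_image, Finset.mem_preimage]
      refine ⟨?_, fun hb => ?_⟩
      · rintro ⟨a, ha, rfl⟩; exact ha
      · obtain ⟨a, _, rfl⟩ := h1 b hb
        exact ⟨a, hb, rfl⟩
    refine ⟨s.preimage φ hφ.injective.injOn, ?_, fun b hb => ?_, fun b hb a ha hab => ?_⟩
    · simpa [PlegmaModels.pullback, hs'] using hs
    · obtain ⟨a, ha, hab⟩ := h1 _ (Finset.mem_preimage.1 hb)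
      exact hφ.injective hab ▸ ha
    · rw [Finset.mem_preimage] at hb ⊢
      exact h2 _ hb _ ⟨a, ha, rfl⟩ (hφ hab)
  · have := h.eq_of_subset hs ht (Finset.image_subset_image hst)
    exact Finset.image_injective hφ.injective this

lemma prepend_zero (𝓕 : Set (Finset ℕ)) : prepend 0 𝓕 = 𝓕 := by
  ext s
  constructor
  · rintro ⟨t, u, ht, hu, -, rfl⟩
    rw [Finset.card_eq_zero] at ht
    simpa [ht] using hu
  · intro hs
    exact ⟨∅, s, rfl, hs, by simp, by simp⟩

/-- The least element of the union lies in the head, which is nonempty and precedes the tail. Each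
derivation thus shortens the head by one, which is why `k` is added on the right of the rank. -/
lemma derived_prepend (k : ℕ) (𝓕 : Set (Finset ℕ)) (n : ℕ) :
    derived (prepend (k + 1) 𝓕) n = above (prepend k 𝓕) n := by
  ext s
  constructor
  · rintro ⟨hs, t, u, ht, hu, htu, heq⟩
    have hn : n ∉ s := fun h => lt_irrefl _ (hs n h)
    have hle : ∀ a ∈ t ∪ u, n ≤ a := by
      rw [← heq]
      intro a ha
      rcases Finset.mem_insert.1 ha with rfl | h
      exacts [le_rfl, (hs a h).le]
    have hnt : n ∈ t := by
      have hn' : n ∈ t ∪ u := heq ▸ Finset.mem_insert_self _ _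
      rcases Finset.mem_union.1 hn' with h | h
      · exact h
      · obtain ⟨a, ha⟩ : t.Nonempty := Finset.card_pos.1 (by omega)
        exact absurd (htu a ha n h) (not_lt.2 (hle a (Finset.mem_union_left _ ha)))
    have hnu : n ∉ u := fun h => lt_irrefl _ (htu n hnt n h)
    refine ⟨⟨t.erase n, u, by rw [Finset.card_erase_of_mem hnt]; omega, hu,
      fun a ha => htu a (Finset.mem_of_mem_erase ha), ?_⟩, hs⟩
    rw [← Finset.erase_insert hn, heq, Finset.erase_union_distrib, Finset.erase_eq_of_notMem hnu]
  · rintro ⟨⟨t, u, ht, hu, htu, rfl⟩, hs⟩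
    have hn : n ∉ t ∪ u := fun h => lt_irrefl _ (hs n h)
    refine ⟨hs, insert n t, u, ?_, hu, ?_, (Finset.insert_union _ _ _).symm⟩
    · rw [Finset.card_insert_of_notMem fun h => hn (Finset.mem_union_left _ h), ht]
    · intro a ha b hb
      rcases Finset.mem_insert.1 ha with rfl | h
      exacts [hs b (Finset.mem_union_right _ hb), htu a h b hb]

lemma IsUniformOn.prepend {α : Ordinal.{0}} {𝓕 : Set (Finset ℕ)}
    (h : IsUniformOn α Set.univ 𝓕) (k : ℕ) :
    IsUniformOn (α + (k : Ordinal.{0})) Set.univ (prepend k 𝓕) := by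
  induction k with
  | zero => simpa [prepend_zero] using h
  | succ k ih =>
    rw [Nat.cast_succ, ← add_assoc]
    refine IsUniformOn.succ _ _ _ fun n hn => ?_
    rw [derived_prepend]
    exact ih.above n

lemma IsBarrier.exists_initSeg_prepend {𝓑 : Set (Finset ℕ)} (h : IsBarrier 𝓑) (k : ℕ) :
    ∀ M : Set ℕ, M.Infinite → ∃ s ∈ prepend k 𝓑, IsInitSegOf s M := by
  induction k with
  | zero => simpa [prepend_zero] using h.1
  | succ k ih =>
    intro M hM
    have hn : sInf M ∈ M := Nat.sInf_mem hM.nonempty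
    set n := sInf M with hndef
    obtain ⟨s, hs, h1, h2⟩ := ih {m | m ∈ M ∧ n < m} (infinite_above hM n)
    have : s ∈ derived (prepend (k + 1) 𝓑) n := by
      rw [derived_prepend]
      exact ⟨hs, fun a ha => (h1 a ha).2⟩
    refine ⟨insert n s, this.2, fun b hb => ?_, fun b hb a ha hab => ?_⟩
    · rcases Finset.mem_insert.1 hb with rfl | hb
      exacts [hn, (h1 b hb).1]
    · have hna : n ≤ a := Nat.sInf_le ha
      rcases hna.eq_or_lt with rfl | hna
      · exact Finset.mem_insert_self _ _
      · rcases Finset.mem_insert.1 hb with rfl | hb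
        · omega
        · exact Finset.mem_insert_of_mem (h2 b hb a ⟨ha, hna⟩ hab)

lemma IsBarrier.prepend {𝓑 : Set (Finset ℕ)} (h : IsBarrier 𝓑) (k : ℕ) :
    IsBarrier (prepend k 𝓑) := by
  refine isBarrier_of_eq_of_subset (h.exists_initSeg_prepend k) ?_
  rintro _ ⟨t, u, ht, hu, htu, rfl⟩ _ ⟨t', u', ht', hu', htu', rfl⟩ hsub
  have hu_sub : u ⊆ u' := by
    intro b hb
    rcases Finset.mem_union.1 (hsub (Finset.mem_union_right _ hb)) with h' | h'
    -- If `b ∈ u` lay in `t'`, all of `t` would lie below `b` and hence in `t'`; then `t = t'` by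
    -- cardinality, and `b` would be in both `t` and `u`.
    · exfalso
      have h1 : t ⊆ t' := by
        intro a ha
        rcases Finset.mem_union.1 (hsub (Finset.mem_union_left _ ha)) with h'' | h''
        · exact h''
        · exact absurd (htu a ha b hb) (not_lt.2 (htu' b h' a h'').le)
      have h2 : t = t' := Finset.eq_of_subset_of_card_le h1 (by omega)
      exact lt_irrefl _ (htu b (h2 ▸ h') b hb)
    · exact h'
  have hu_eq := h.eq_of_subset hu hu' hu_sub
  subst hu_eq
  have h1 : t ⊆ t' := by
    intro a ha
    rcases Finset.mem_union.1 (hsub (Finset.mem_union_left _ ha)) with h'' | h''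
    · exact h''
    · exact absurd (htu a ha a h'') (lt_irrefl _)
  rw [Finset.eq_of_subset_of_card_le h1 (by omega)]

lemma IsUniformBarrier.pullback {φ : ℕ → ℕ} (hφ : StrictMono φ) {ξ : Ordinal.{0}}
    {𝓑 : Set (Finset ℕ)} (h : IsUniformBarrier ξ 𝓑) : IsUniformBarrier ξ (pullback φ 𝓑) :=
  ⟨h.1.pullback hφ, h.2.pullback hφ _ Set.infinite_univ fun _ _ => Set.mem_univ _⟩

lemma IsUniformBarrier.prepend {ξ : Ordinal.{0}} {𝓑 : Set (Finset ℕ)}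
    (h : IsUniformBarrier ξ 𝓑) (k : ℕ) :
    IsUniformBarrier (ξ + (k : Ordinal.{0})) (prepend k 𝓑) :=
  ⟨h.1.prepend k, h.2.prepend k⟩

end PlegmaModels

namespace PlegmaModels

/-! ### Sparse sets on which a uniform barrier is monotone -/

lemma exists_strictMono_rec (g : ℕ → ℕ → ℕ) :
    ∃ l : ℕ → ℕ, StrictMono l ∧ ∀ q, g q (l q) ≤ l (q + 1) := by
  let l : ℕ → ℕ := fun q => Nat.rec 0 (fun q a => max (a + 1) (g q a)) q
  have hl : ∀ q, l (q + 1) = max (l q + 1) (g q (l q)) := fun q => rfl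
  refine ⟨l, strictMono_nat_of_lt_succ fun q => ?_, fun q => ?_⟩
  · rw [hl]
    exact lt_of_lt_of_le (Nat.lt_succ_self _) (le_max_left _ _)
  · rw [hl]
    exact le_max_right _ _

/-- A family together with a set and a rank, intended to be uniform of that rank on that set. -/
structure Node where
  /-- the rank of the family -/
  rank : Ordinal.{0}
  /-- the set on which the family is uniform -/
  dom : Set ℕ
  /-- the family -/
  fam : Set (Finset ℕ)

/-- The family of the node is a uniform antichain. -/
structure Node.Good (σ : Node) : Prop where
  uniform : IsUniformOn σ.rank σ.dom σ.fam
  infinite : σ.dom.Infinite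
  antichain : ∀ s ∈ σ.fam, ∀ t ∈ σ.fam, s ⊆ t → s = t

/-- Puts successor and limit ranks on the same footing: every rank below `α` is eventually attained
or exceeded by the derived families, which is all the sparseness argument needs. -/
lemma IsUniformOn.exists_derived_rank {α : Ordinal.{0}} {M : Set ℕ} {𝓕 : Set (Finset ℕ)}
    (h : IsUniformOn α M 𝓕) (h0 : α ≠ 0) :
    ∃ c : ℕ → Ordinal.{0},
      (∀ n ∈ M, IsUniformOn (c n) {m | m ∈ M ∧ n < m} (derived 𝓕 n) ∧ c n < α) ∧
      ∀ β < α, ∀ᶠ n in atTop, n ∈ M → β ≤ c n := by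
  cases h with
  | zero M => exact absurd rfl h0
  | succ β M 𝓕 h =>
    exact ⟨fun _ => β, fun n hn => ⟨h n hn, Order.lt_add_one_iff.2 le_rfl⟩,
      fun γ hγ => Eventually.of_forall fun n _ => Order.lt_add_one_iff.1 hγ⟩
  | limit α M 𝓕 a hα hmono hlt hsup h =>
    refine ⟨a, fun n hn => ⟨h n hn, hlt n hn⟩, fun β hβ => ?_⟩
    obtain ⟨n, hn, hβn⟩ := hsup β hβ
    filter_upwards [eventually_ge_atTop n] with m hm hmM
    exact hβn.le.trans (hmono hn hmM hm)

open Classical in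
/-- The ranks of the derived families of a node. -/
noncomputable def Node.childRank (σ : Node) : ℕ → Ordinal.{0} :=
  if h : IsUniformOn σ.rank σ.dom σ.fam ∧ σ.rank ≠ 0 then
    (h.1.exists_derived_rank h.2).choose else fun _ => 0

/-- The node of the derived family. -/
noncomputable def Node.step (σ : Node) (n : ℕ) : Node :=
  ⟨σ.childRank n, {m | m ∈ σ.dom ∧ n < m}, derived σ.fam n⟩

lemma Node.Good.childRank_spec {σ : Node} (h : σ.Good) (h0 : σ.rank ≠ 0) :
    (∀ n ∈ σ.dom, IsUniformOn (σ.childRank n) {m | m ∈ σ.dom ∧ n < m} (derived σ.fam n) ∧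
      σ.childRank n < σ.rank) ∧
      ∀ β < σ.rank, ∀ᶠ n in atTop, n ∈ σ.dom → β ≤ σ.childRank n := by
  rw [Node.childRank, dif_pos ⟨h.uniform, h0⟩]
  exact (h.uniform.exists_derived_rank h0).choose_spec

lemma Node.Good.step {σ : Node} (h : σ.Good) (h0 : σ.rank ≠ 0) {n : ℕ} (hn : n ∈ σ.dom) :
    (σ.step n).Good := by
  refine ⟨((h.childRank_spec h0).1 n hn).1, infinite_above h.infinite n, fun s hs t ht hst => ?_⟩
  have := h.antichain _ hs.2 _ ht.2 (Finset.insert_subset_insert _ hst)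
  have h1 : n ∉ s := fun h => lt_irrefl _ (hs.1 n h)
  have h2 : n ∉ t := fun h => lt_irrefl _ (ht.1 n h)
  rw [← Finset.erase_insert h1, this, Finset.erase_insert h2]

lemma Node.Good.empty_mem_of_rank_eq_zero {σ : Node} (h : σ.Good) (h0 : σ.rank = 0) :
    ∅ ∈ σ.fam := by
  obtain ⟨α, M, 𝓕⟩ := σ
  obtain ⟨hu, -, -⟩ := h
  dsimp only at h0 hu ⊢
  cases hu with
  | zero M => exact rfl
  | succ β M 𝓕 h => exact absurd h0 (zero_le.trans_lt (Order.lt_add_one_iff.2 (le_refl β))).ne'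
  | limit α M 𝓕 a hα hmono hlt hsup h =>
    subst h0
    exact absurd isMin_bot hα.1

lemma Node.Good.empty_notMem {σ : Node} (h : σ.Good) (h0 : σ.rank ≠ 0) : ∅ ∉ σ.fam := by
  intro hmem
  obtain ⟨n, hn⟩ := h.infinite.nonempty
  obtain ⟨s, hs⟩ := (h.step h0 hn).uniform.nonempty (h.step h0 hn).infinite
  exact (Finset.insert_nonempty n s).ne_empty
    (h.antichain _ hmem _ hs.2 (Finset.empty_subset _)).symm

/-- The nodes reached from `ρ` along increasing sequences of numbers smaller than `n`. -/
def reach (ρ : Node) : ℕ → Set Node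
  | 0 => {ρ}
  | n + 1 => reach ρ n ∪ (fun σ => σ.step n) '' reach ρ n

lemma finite_reach (ρ : Node) (n : ℕ) : (reach ρ n).Finite := by
  induction n with
  | zero => exact Set.finite_singleton _
  | succ n ih => exact ih.union (ih.image _)

lemma monotone_reach (ρ : Node) : Monotone (reach ρ) :=
  monotone_nat_of_le_succ fun _ => Set.subset_union_left

lemma self_mem_reach (ρ : Node) (n : ℕ) : ρ ∈ reach ρ n :=
  monotone_reach ρ (Nat.zero_le n) rfl

lemma step_mem_reach {ρ σ : Node} {n : ℕ} (h : σ ∈ reach ρ n) : σ.step n ∈ reach ρ (n + 1) :=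
  Or.inr ⟨σ, h, rfl⟩

/-- The members of `l` are so sparse that passing to a later child preserves
the order of the ranks. -/
def RankMonotoneAlong (ρ : Node) (l : ℕ → ℕ) : Prop :=
  ∀ p, ∀ σ ∈ reach ρ (l p + 1), ∀ τ ∈ reach ρ (l p + 1), ∀ m < l p + 1,
    σ.Good → τ.Good → σ.rank ≤ τ.rank → σ.rank ≠ 0 → m ∈ σ.dom →
    ∀ n ∈ τ.dom, l (p + 1) ≤ n → (σ.step m).rank ≤ (τ.step n).rank

/-- A child of `σ` has rank below `σ.rank ≤ τ.rank`, so all sufficiently late children of `τ` have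
at least that rank. Only finitely many `σ`, `τ`, `m` occur at each stage, so one threshold serves
them all, and `l` jumps past the thresholds. -/
lemma exists_rankMonotoneAlong (ρ : Node) :
    ∃ l : ℕ → ℕ, StrictMono l ∧ RankMonotoneAlong ρ l := by
  have key : ∀ k, ∀ᶠ n in atTop, ∀ σ ∈ reach ρ k, ∀ τ ∈ reach ρ k, ∀ m ∈ Set.Iio k,
      σ.Good → τ.Good → σ.rank ≤ τ.rank → σ.rank ≠ 0 → m ∈ σ.dom →
      n ∈ τ.dom → (σ.step m).rank ≤ (τ.step n).rank := by
    intro k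
    refine (eventually_all_finite (finite_reach ρ k)).2 fun σ _ => ?_
    refine (eventually_all_finite (finite_reach ρ k)).2 fun τ _ => ?_
    refine (eventually_all_finite (Set.finite_Iio k)).2 fun m _ => ?_
    by_cases H : σ.Good ∧ τ.Good ∧ σ.rank ≤ τ.rank ∧ σ.rank ≠ 0 ∧ m ∈ σ.dom
    · obtain ⟨hσ, hτ, hle, h0, hm⟩ := H
      have h0' : τ.rank ≠ 0 := fun h => h0 (le_antisymm (h ▸ hle) (zero_le))
      filter_upwards [(hτ.childRank_spec h0').2 _
        ((((hσ.childRank_spec h0).1 m hm).2).trans_le hle)] with n hn _ _ _ _ _ hnd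
      exact hn hnd
    · exact Eventually.of_forall fun n h1 h2 h3 h4 h5 _ => absurd ⟨h1, h2, h3, h4, h5⟩ H
  choose N hN using fun k => eventually_atTop.1 (key k)
  obtain ⟨l, hl, hlN⟩ := exists_strictMono_rec fun _ a => N (a + 1)
  refine ⟨l, hl, fun p σ hσ τ hτ m hm h1 h2 h3 h4 h5 n hn hpn => ?_⟩
  exact hN (l p + 1) n ((hlN p).trans hpn) σ hσ τ hτ m hm h1 h2 h3 h4 h5 hn

/-- Both lists are read simultaneously, keeping the rank of `σ` at most that of `τ`. When `ss` is
exhausted `τ` has rank `0`, hence so has `σ`; if `σ` reaches rank `0` earlier, the part of `ds`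
already read suffices. -/
lemma RankMonotoneAlong.exists_take_mem {ρ : Node} {l : ℕ → ℕ} (hl : StrictMono l)
    (h : RankMonotoneAlong ρ l) :
    ∀ (ss ds : List ℕ) (σ τ : Node), σ.Good → τ.Good → σ.rank ≤ τ.rank →
      (∀ d ∈ ds, σ ∈ reach ρ (l d)) → (∀ e ∈ ss, ∀ p, p + 1 = e → τ ∈ reach ρ (l p + 1)) →
      ds.Pairwise (· < ·) → ss.Pairwise (· < ·) → ss.length ≤ ds.length →
      (∀ p (hs : p < ss.length) (hd : p < ds.length), ds[p] < ss[p]) →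
      (∀ d ∈ ds, l d ∈ σ.dom) → (∀ e ∈ ss, l e ∈ τ.dom) →
      (ss.map l).toFinset ∈ τ.fam → ∃ p ≤ ss.length, ((ds.take p).map l).toFinset ∈ σ.fam := by
  intro ss
  induction ss with
  | nil =>
    intro ds σ τ hσ hτ hle _ _ _ _ _ _ _ _ hmem
    have hτ0 : τ.rank = 0 := by
      by_contra h0
      exact hτ.empty_notMem h0 (by simpa using hmem)
    have hσ0 : σ.rank = 0 := le_antisymm (hτ0 ▸ hle) (zero_le)
    exact ⟨0, le_rfl, by simpa using hσ.empty_mem_of_rank_eq_zero hσ0⟩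
  | cons e ss ih =>
    intro ds σ τ hσ hτ hle hrσ hrτ hds hss hlen hlt hdσ heτ hmem
    by_cases h0 : σ.rank = 0
    · exact ⟨0, Nat.zero_le _, by simpa using hσ.empty_mem_of_rank_eq_zero h0⟩
    have h0' : τ.rank ≠ 0 := fun h => h0 (le_antisymm (h ▸ hle) (zero_le))
    cases ds with
    | nil => simp at hlen
    | cons d ds =>
      rw [List.pairwise_cons] at hds hss
      have hde : d < e := hlt 0 (by simp) (by simp)
      -- From `d < e` one gets `d ≤ p`, so both nodes and `l d` fall within stage `p` of the
      -- sparseness condition, while `l e` is past its threshold.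
      obtain ⟨p, rfl⟩ : ∃ p, e = p + 1 := ⟨e - 1, by omega⟩
      have hd := hdσ d (by simp)
      have he := heτ (p + 1) (by simp)
      have hτp := hrτ (p + 1) (by simp) p rfl
      have hσd := hrσ d (by simp)
      have hdp : l d ≤ l p := hl.monotone (Nat.lt_succ_iff.1 hde)
      have hτe : τ ∈ reach ρ (l (p + 1)) := monotone_reach ρ (hl (Nat.lt_succ_self p)) hτp
      have hle' := h p σ (monotone_reach ρ (hdp.trans (Nat.le_succ _)) hσd) τ hτp (l d)
        (Nat.lt_succ_of_le hdp) hσ hτ hle h0 hd (l (p + 1)) he le_rfl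
      obtain ⟨q, hq, hmem'⟩ := ih ds (σ.step (l d)) (τ.step (l (p + 1))) (hσ.step h0 hd)
        (hτ.step h0' he) hle'
        (fun d' hd' => monotone_reach ρ (hl (hds.1 d' hd')) (step_mem_reach hσd))
        (fun e' he' p' hp' => monotone_reach ρ
          (Nat.succ_le_succ (hl.monotone (by have := hss.1 e' he'; omega))) (step_mem_reach hτe))
        hds.2 hss.2 (by simpa using hlen)
        (fun p hs hd => by
          exact hlt (p + 1) (by simpa using hs) (by simpa using hd))
        (fun d' hd' => ⟨hdσ d' (by simp [hd']), hl (hds.1 d' hd')⟩)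
        (fun e' he' => ⟨heτ e' (by simp [he']), hl (hss.1 e' he')⟩)
        ⟨fun a ha => by
          simp only [List.mem_toFinset, List.mem_map] at ha
          obtain ⟨b, hb, rfl⟩ := ha
          exact hl (hss.1 b hb), by simpa using hmem⟩
      exact ⟨q + 1, by simpa using hq, by simpa using hmem'.2⟩

/-- Subsets of `{l 0, l 1, …}` which lie pointwise strictly below a member of `𝓑` have an initial
segment in `𝓑`. -/
def IsMonotoneAlong (𝓑 : Set (Finset ℕ)) (l : ℕ → ℕ) : Prop :=
  ∀ ss ds : List ℕ, ds.Pairwise (· < ·) → ss.Pairwise (· < ·) → ss.length ≤ ds.length →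
    (∀ p (hs : p < ss.length) (hd : p < ds.length), ds[p] < ss[p]) →
    (ss.map l).toFinset ∈ 𝓑 → ∃ p ≤ ss.length, ((ds.take p).map l).toFinset ∈ 𝓑

lemma IsUniformBarrier.exists_isMonotoneAlong {ξ : Ordinal.{0}} {𝓑 : Set (Finset ℕ)}
    (h : IsUniformBarrier ξ 𝓑) : ∃ l : ℕ → ℕ, StrictMono l ∧ IsMonotoneAlong 𝓑 l := by
  obtain ⟨l, hl, hlr⟩ := exists_rankMonotoneAlong ⟨ξ, Set.univ, 𝓑⟩
  have hgood : (⟨ξ, Set.univ, 𝓑⟩ : Node).Good :=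
    ⟨h.2, Set.infinite_univ, fun s hs t ht => h.1.eq_of_subset hs ht⟩
  refine ⟨l, hl, fun ss ds hds hss hlen hlt hmem => ?_⟩
  exact hlr.exists_take_mem hl ss ds _ _ hgood hgood le_rfl (fun _ _ => self_mem_reach _ _)
    (fun _ _ _ _ => self_mem_reach _ _) hds hss hlen hlt (fun _ _ => Set.mem_univ _)
    (fun _ _ => Set.mem_univ _) hmem

end PlegmaModels

namespace PlegmaModels

/-! ### Plegma sequences of lists -/

/-- The condition on plegma sequences that concerns the order of the elements. -/
def IsInterlaced {n : ℕ} (v : Fin n → List ℕ) : Prop :=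
  (∀ i j : Fin n, i < j → ∀ (p : ℕ) (hi : p < (v i).length) (hj : p < (v j).length),
    (v i)[p] < (v j)[p]) ∧
  (∀ i j : Fin n, ∀ (p : ℕ) (hi : p < (v i).length) (hj : p + 1 < (v j).length),
    (v i)[p] < (v j)[p + 1])

lemma isPlegma_iff {n : ℕ} (s : Fin n → Finset ℕ) : IsPlegma s ↔
    (∀ i j : Fin n, i ≤ j → (s i).card ≤ (s j).card) ∧ IsInterlaced fun i => (s i).sort := by
  simp only [IsPlegma, IsInterlaced, Finset.orderEmbOfFin_apply, Finset.length_sort,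
    Fin.getElem_fin]

lemma sort_toFinset_of_pairwise {v : List ℕ} (hv : v.Pairwise (· < ·)) : v.toFinset.sort = v :=
  (List.toFinset_sort _ (hv.imp ne_of_lt)).2 (hv.imp le_of_lt)

lemma card_toFinset_of_pairwise {v : List ℕ} (hv : v.Pairwise (· < ·)) :
    v.toFinset.card = v.length :=
  List.toFinset_card_of_nodup (hv.imp ne_of_lt)

lemma pairwise_sort_lt (s : Finset ℕ) : s.sort.Pairwise (· < ·) :=
  s.sortedLT_sort.pairwise

lemma isPlegma_toFinset_iff {n : ℕ} {v : Fin n → List ℕ} (hv : ∀ i, (v i).Pairwise (· < ·)) :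
    IsPlegma (fun i => (v i).toFinset) ↔
      (∀ i j : Fin n, i ≤ j → (v i).length ≤ (v j).length) ∧ IsInterlaced v := by
  simp only [isPlegma_iff, sort_toFinset_of_pairwise (hv _), card_toFinset_of_pairwise (hv _)]

lemma pairwise_map_of_strictMono {φ : ℕ → ℕ} (hφ : StrictMono φ) {v : List ℕ}
    (hv : v.Pairwise (· < ·)) : (v.map φ).Pairwise (· < ·) :=
  List.pairwise_map.2 (hv.imp fun h => hφ h)

lemma IsInterlaced.map {n : ℕ} {v : Fin n → List ℕ} (h : IsInterlaced v) {φ : ℕ → ℕ}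
    (hφ : StrictMono φ) : IsInterlaced fun i => (v i).map φ := by
  refine ⟨fun i j hij p hi hj => ?_, fun i j p hi hj => ?_⟩
  · simpa using hφ (h.1 i j hij p (by simpa using hi) (by simpa using hj))
  · simpa using hφ (h.2 i j p (by simpa using hi) (by simpa using hj))

lemma IsInterlaced.take {n : ℕ} {v : Fin n → List ℕ} (h : IsInterlaced v) (k : ℕ) :
    IsInterlaced fun i => (v i).take k := by
  refine ⟨fun i j hij p hi hj => ?_, fun i j p hi hj => ?_⟩ <;>
    simp only [List.length_take, lt_min_iff] at hi hj
  · simpa using h.1 i j hij p hi.2 hj.2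
  · simpa using h.2 i j p hi.2 hj.2

lemma IsInterlaced.drop {n : ℕ} {v : Fin n → List ℕ} (h : IsInterlaced v) (k : ℕ) :
    IsInterlaced fun i => (v i).drop k := by
  refine ⟨fun i j hij p hi hj => ?_, fun i j p hi hj => ?_⟩ <;>
    simp only [List.length_drop] at hi hj
  · simpa using h.1 i j hij (k + p) (by omega) (by omega)
  · simpa [add_assoc] using h.2 i j (k + p) (by omega) (by omega)

/-- Every element among the first `k` of one member of an interlaced family lies below every
other element of any other member. -/
lemma IsInterlaced.lt_of_mem_take_of_mem_drop {n : ℕ} {v : Fin n → List ℕ} (h : IsInterlaced v)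
    (hv : ∀ i, (v i).Pairwise (· < ·)) {k : ℕ} {i j : Fin n} {a b : ℕ}
    (ha : a ∈ (v i).take k) (hb : b ∈ (v j).drop k) : a < b := by
  obtain ⟨p, hp, rfl⟩ := List.getElem_of_mem ha
  obtain ⟨q, hq, rfl⟩ := List.getElem_of_mem hb
  simp only [List.length_take, lt_min_iff, List.length_drop] at hp hq
  simp only [List.getElem_take, List.getElem_drop]
  have h1 := h.2 i j p hp.2 (by omega)
  refine h1.trans_le ?_
  rcases (show p + 1 ≤ k + q by omega).eq_or_lt with h2 | h2
  · simp [h2]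
  · exact (List.pairwise_iff_getElem.1 (hv j) _ _ (by omega) (by omega) h2).le

lemma mem_prepend_iff {k : ℕ} {𝓕 : Set (Finset ℕ)} {s : Finset ℕ} : s ∈ prepend k 𝓕 ↔
    k ≤ s.card ∧ (s.sort.drop k).toFinset ∈ 𝓕 := by
  constructor
  · rintro ⟨t, u, ht, hu, htu, rfl⟩
    have hsort : (t ∪ u).sort = t.sort ++ u.sort := by
      simpa using sort_toFinset_of_pairwise
        (List.pairwise_append.2 ⟨pairwise_sort_lt t, pairwise_sort_lt u, by simpa using htu⟩)
    refine ⟨ht ▸ Finset.card_le_card Finset.subset_union_left, ?_⟩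
    rw [hsort, List.drop_append_of_le_length (by simp [ht]), List.drop_of_length_le (by simp [ht])]
    simpa using hu
  · rintro ⟨hk, hs⟩
    have hp := pairwise_sort_lt s
    refine ⟨(s.sort.take k).toFinset, _, ?_, hs, ?_, ?_⟩
    · rw [card_toFinset_of_pairwise hp.take]
      simpa using hk
    · rw [← List.take_append_drop k (s.sort (· ≤ ·))] at hp
      simpa using (List.pairwise_append.1 hp).2.2
    · rw [← List.toFinset_append, List.take_append_drop, Finset.sort_toFinset]

/-! ### Shifted members of a barrier -/

/-- The initial segment, belonging to `𝓑`, of the set of all `l (h b + j)`, `b ∈ u`. -/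
noncomputable def shifted (𝓑 : Set (Finset ℕ)) (l h : ℕ → ℕ) (j : ℕ) (u : List ℕ) : Finset ℕ :=
  open Classical in
  if H : ∃ p, (((u.take p).map fun b => h b + j).map l).toFinset ∈ 𝓑 then
    (((u.take H.choose).map fun b => h b + j).map l).toFinset else ∅

/-- The points `h b + j` lie strictly below the points `h (b + 1)`, whose image under `l` is in `𝓑`;
monotonicity then provides the initial segment, so the default value is not used. -/
lemma shifted_spec {𝓑 : Set (Finset ℕ)} {l h : ℕ → ℕ} (hB : IsMonotoneAlong 𝓑 l)
    (hh : StrictMono h) {j : ℕ} {u : List ℕ} (hu : u.Pairwise (· < ·))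
    (hj : ∀ b ∈ u, h b + j < h (b + 1)) (hmem : ((u.map fun b => h (b + 1)).map l).toFinset ∈ 𝓑) :
    ∃ p, shifted 𝓑 l h j u = (((u.take p).map fun b => h b + j).map l).toFinset ∧
      shifted 𝓑 l h j u ∈ 𝓑 := by
  have H : ∃ p, (((u.take p).map fun b => h b + j).map l).toFinset ∈ 𝓑 := by
    obtain ⟨p, -, hp⟩ := hB (u.map fun b => h (b + 1)) (u.map fun b => h b + j)
      (pairwise_map_of_strictMono (fun a b hab => Nat.add_lt_add_right (hh hab) j) hu)
      (pairwise_map_of_strictMono (fun a b hab => hh (Nat.succ_lt_succ hab)) hu) (by simp)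
      (fun p hs hd => by simpa using hj _ (List.getElem_mem _)) hmem
    exact ⟨p, by rwa [List.map_take]⟩
  rw [shifted, dif_pos H]
  exact ⟨_, rfl, H.choose_spec⟩

/-- All `N` shifts of `h b` fit below `h (b + 1)`. Hence the shift orders the sets coming from one
`u i`, and interlacing orders those coming from different ones. -/
lemma isPlegma_shifted {𝓑 : Set (Finset ℕ)} {l h : ℕ → ℕ} (hbar : IsBarrier 𝓑)
    (hB : IsMonotoneAlong 𝓑 l) (hl : StrictMono l) (hh : StrictMono h) {n N : ℕ}
    {u : Fin n → List ℕ} (hu : ∀ i, (u i).Pairwise (· < ·)) (hint : IsInterlaced u)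
    (hN : ∀ i, ∀ b ∈ u i, h b + N ≤ h (b + 1))
    (hmem : ∀ i, (((u i).map fun b => h (b + 1)).map l).toFinset ∈ 𝓑)
    {ι : Fin N → Fin n} (hι : Monotone ι) :
    IsPlegma fun j : Fin N => shifted 𝓑 l h j (u (ι j)) := by
  have hspec := fun j : Fin N => shifted_spec hB hh (hu (ι j))
    (fun b hb => (Nat.add_lt_add_left j.2 _).trans_le (hN _ b hb)) (hmem (ι j))
  choose p hp hpmem using hspec
  set W : Fin N → List ℕ := fun j => ((u (ι j)).take (p j)).map fun b => h b + j with hW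
  have hWs : ∀ j, (W j).Pairwise (· < ·) := fun j =>
    pairwise_map_of_strictMono (fun a b hab => Nat.add_lt_add_right (hh hab) j) (hu _).take
  have hWB : ∀ j, ((W j).map l).toFinset ∈ 𝓑 := fun j => by
    have := hpmem j
    rwa [hp j] at this
  have hWint : IsInterlaced W := by
    refine ⟨fun i j hij q hi hj => ?_, fun i j q hi hj => ?_⟩
    · simp only [hW, List.length_map, List.length_take, lt_min_iff] at hi hj
      simp only [hW, List.getElem_map, List.getElem_take]
      have hle : (u (ι i))[q] ≤ (u (ι j))[q] := by
        rcases (hι hij.le).eq_or_lt with h | h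
        · simp only [h, le_refl]
        · exact (hint.1 _ _ h q hi.2 hj.2).le
      exact add_lt_add_of_le_of_lt (hh.monotone hle) hij
    · simp only [hW, List.length_map, List.length_take, lt_min_iff] at hi hj
      simp only [hW, List.getElem_map, List.getElem_take]
      have h1 := hint.2 (ι i) (ι j) q hi.2 hj.2
      have h2 := hN (ι i) _ (List.getElem_mem hi.2)
      have h3 := hh.monotone (Nat.succ_le_of_lt h1)
      have h4 := i.2
      simp only [Nat.succ_eq_add_one] at h3
      omega
  have hlen : ∀ i j, i ≤ j → (W i).length ≤ (W j).length := by
    intro i j hij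
    rcases hij.eq_or_lt with rfl | hij
    · exact le_rfl
    -- If `W i` were longer than `W j`, monotonicity would put a proper initial segment of `W i` in
    -- `𝓑`, against the antichain property.
    by_contra! hlt
    obtain ⟨q, hq, hqB⟩ := hB (W j) (W i) (hWs i) (hWs j) hlt.le
      (fun q hs hd => hWint.1 i j hij q hd hs) (hWB j)
    have heq := hbar.eq_of_subset hqB (hWB i) (by
      intro a
      simp only [List.mem_toFinset, List.mem_map]
      exact fun ⟨b, hb, hab⟩ => ⟨b, List.mem_of_mem_take hb, hab⟩)
    have hcard := congrArg Finset.card heq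
    rw [card_toFinset_of_pairwise (pairwise_map_of_strictMono hl (hWs i).take),
      card_toFinset_of_pairwise (pairwise_map_of_strictMono hl (hWs i))] at hcard
    simp only [List.length_map, List.length_take] at hcard
    simp only [W] at hlt hq hcard
    simp only [List.length_map, List.length_take] at hlt hq hcard
    omega
  have := (isPlegma_toFinset_iff fun j => pairwise_map_of_strictMono hl (hWs j)).2
    ⟨by simpa using hlen, hWint.map hl⟩
  convert this using 2 with j
  exact hp j

end PlegmaModels

namespace PlegmaModels

/-! ### Estimates for norms of linear combinations -/

section Estimates

variable {X E : Type*} [NormedAddCommGroup X] [NormedSpace ℝ X]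
  [NormedAddCommGroup E] [NormedSpace ℝ E]

/-- A bound for coefficients in `[-1, 1]` gives by homogeneity a bound for all coefficients. -/
lemma abs_norm_sum_sub_norm_sum_le {ι : Type*} [Fintype ι] {e : ι → E} {x : ι → X} {δ : ℝ}
    (h : ∀ a : ι → ℝ, (∀ i, a i ∈ Set.Icc (-1 : ℝ) 1) →
      |‖∑ i, a i • e i‖ - ‖∑ i, a i • x i‖| < δ) {K : ℝ} (hK : 0 < K) {b : ι → ℝ}
    (hb : ∀ i, |b i| ≤ K) : |‖∑ i, b i • e i‖ - ‖∑ i, b i • x i‖| ≤ K * δ := by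
  have h1 := h (fun i => K⁻¹ * b i) fun i => by
    rw [Set.mem_Icc, ← abs_le, abs_mul, abs_inv, abs_of_pos hK, inv_mul_le_iff₀ hK, mul_one]
    exact hb i
  simp only [mul_smul, ← Finset.smul_sum, norm_smul, norm_inv, Real.norm_eq_abs,
    abs_of_pos hK] at h1
  rw [← mul_sub, abs_mul, abs_inv, abs_of_pos hK, inv_mul_lt_iff₀ hK] at h1
  exact h1.le

/-- Take for `ι j` the last block whose support has begun by `j`; this is monotone also at indices
outside every support. -/
lemma exists_monotone_index {n : ℕ} (hn : 0 < n) {c : Fin n → ℕ →₀ ℝ}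
    (hc : ∀ i j, i < j → ∀ p ∈ (c i).support, ∀ q ∈ (c j).support, p < q) :
    ∃ ι : ℕ → Fin n, Monotone ι ∧ ∀ i j, c i j ≠ 0 → ι j = i := by
  classical
  have : NeZero n := ⟨hn.ne'⟩
  refine ⟨fun j => (Finset.univ.filter fun i => ∃ p ∈ (c i).support, p ≤ j).sup id,
    fun j j' hj => Finset.sup_mono ?_, fun i j hij => le_antisymm (Finset.sup_le ?_) ?_⟩
  · intro i
    simp only [Finset.mem_filter, Finset.mem_univ, true_and]
    exact fun ⟨p, hp, hpj⟩ => ⟨p, hp, hpj.trans hj⟩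
  · intro i' hi'
    simp only [Finset.mem_filter, Finset.mem_univ, true_and] at hi'
    obtain ⟨p, hp, hpj⟩ := hi'
    by_contra! hlt
    exact absurd (hc i i' hlt j (Finsupp.mem_support_iff.2 hij) p hp) (not_lt.2 hpj)
  · exact Finset.le_sup (f := id) (Finset.mem_filter.2
      ⟨Finset.mem_univ _, j, Finsupp.mem_support_iff.2 hij, le_rfl⟩)

/-- Each `j` meets at most one block, so the double sum collapses. The vectors `g` are arbitrary so
that the identity serves both for the basis of `F` and for the matrix in `X`. -/
lemma sum_smul_finsuppSum_eq {n N : ℕ} {c : Fin n → ℕ →₀ ℝ} {ι : ℕ → Fin n}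
    (hι : ∀ i j, c i j ≠ 0 → ι j = i) (hN : ∀ i j, c i j ≠ 0 → j < N) (a : Fin n → ℝ)
    (g : Fin n → ℕ → X) :
    ∑ i, a i • (c i).sum (fun j q => q • g i j) =
      ∑ j : Fin N, (a (ι j) * c (ι j) j) • g (ι j) j := by
  have h1 : ∀ i, a i • (c i).sum (fun j q => q • g i j) =
      ∑ j : Fin N, (a i * c i j) • g i j := by
    intro i
    rw [Finsupp.sum_of_support_subset (c i) (s := Finset.range N)
      (fun j hj => Finset.mem_range.2 (hN i j (Finsupp.mem_support_iff.1 hj))) _ (by simp),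
      Finset.sum_range, Finset.smul_sum]
    simp only [mul_smul]
  rw [Finset.sum_congr rfl fun i _ => h1 i, Finset.sum_comm]
  refine Finset.sum_congr rfl fun j _ => Finset.sum_eq_single _ (fun i _ hi => ?_) (by simp)
  have : c i j = 0 := by
    by_contra h
    exact hi (hι i j h).symm
  simp [this]

lemma exists_bounds (c : ℕ → Finset ℕ → ℕ →₀ ℝ) (A : ℕ) : ∃ (N : ℕ) (K : ℝ), 0 < K ∧
    ∀ i < A, ∀ t ⊆ Finset.range A, ∀ j, |c i t j| ≤ K ∧ (c i t j ≠ 0 → j < N) := by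
  set S := Finset.range A ×ˢ (Finset.range A).powerset with hS
  refine ⟨S.sup fun p => (c p.1 p.2).support.sup (· + 1),
    ∑ p ∈ S, ∑ j ∈ (c p.1 p.2).support, |c p.1 p.2 j| + 1, by positivity, ?_⟩
  intro i hi t ht j
  have hmem : (i, t) ∈ S := by simp [hS, hi, ht]
  by_cases h0 : c i t j = 0
  · refine ⟨?_, fun h => absurd h0 h⟩
    rw [h0, abs_zero]
    positivity
  have hj : j ∈ (c i t).support := Finsupp.mem_support_iff.2 h0
  constructor
  · have h1 := Finset.single_le_sum (f := fun j => |c i t j|) (fun _ _ => abs_nonneg _) hj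
    have h2 := Finset.single_le_sum (f := fun p : ℕ × Finset ℕ =>
      ∑ j ∈ (c p.1 p.2).support, |c p.1 p.2 j|)
      (fun _ _ => Finset.sum_nonneg fun _ _ => abs_nonneg _) hmem
    dsimp only at h1 h2
    linarith
  · intro _
    have h1 := Finset.le_sup (f := (· + 1)) hj
    have h2 := Finset.le_sup (f := fun p : ℕ × Finset ℕ => (c p.1 p.2).support.sup (· + 1)) hmem
    dsimp only at h1 h2
    omega

lemma norm_sub_inv_norm_smul {v : X} (hv : v ≠ 0) : ‖v - ‖v‖⁻¹ • v‖ = |‖v‖ - 1| := by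
  have h0 : ‖v‖ ≠ 0 := norm_ne_zero_iff.2 hv
  have : v - ‖v‖⁻¹ • v = (1 - ‖v‖⁻¹) • v := by rw [sub_smul, one_smul]
  rw [this, norm_smul, Real.norm_eq_abs, ← abs_of_nonneg (norm_nonneg v), ← abs_mul,
    abs_of_nonneg (norm_nonneg v), sub_mul, inv_mul_cancel₀ h0, one_mul]

end Estimates

/-! ### Fast-growing index sequences. -/

lemma exists_strictMono_mem_le {M : Set ℕ} (hM : M.Infinite) (b : ℕ → ℕ) :
    ∃ μ : ℕ → ℕ, StrictMono μ ∧ (∀ m, μ m ∈ M) ∧ ∀ n m, n < m → b n ≤ μ m := by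
  obtain ⟨l, hl, hlb⟩ := exists_strictMono_rec fun q _ => (Finset.range (q + 1)).sup b
  have hnth := Nat.nth_strictMono hM
  refine ⟨fun m => Nat.nth (· ∈ M) (l m), hnth.comp hl, fun m => Nat.nth_mem_of_infinite hM _,
    fun n m hnm => ?_⟩
  obtain ⟨q, rfl⟩ : ∃ q, m = q + 1 := ⟨m - 1, by omega⟩
  exact (Finset.le_sup (Finset.mem_range.2 hnm)).trans ((hlb q).trans (hnth.id_le _))

/-- Sparse sequences along which blocks of bounded length can be separated. -/
lemma exists_strictMono_gap (N G : ℕ → ℕ) : ∃ h : ℕ → ℕ, StrictMono h ∧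
    (∀ a b, a ≤ b → h b + N a ≤ h (b + 1)) ∧ ∀ a, 0 < a → G a < h a := by
  obtain ⟨h, hh, hg⟩ := exists_strictMono_rec fun q x =>
    x + (Finset.range (q + 1)).sup N + G (q + 1) + 1
  refine ⟨h, hh, fun a b hab => ?_, fun a ha => ?_⟩
  · have h1 := Finset.le_sup (f := N) (Finset.mem_range.2 (Nat.lt_succ_of_le hab))
    have h2 := hg b
    simp only [Nat.succ_eq_add_one] at h1
    omega
  · obtain ⟨q, rfl⟩ : ∃ q, a = q + 1 := ⟨a - 1, by omega⟩
    have h2 := hg q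
    omega

/-! ### Transfer of block vectors from `F` to `X`. -/

section Main

variable {X F E : Type*} [NormedAddCommGroup X] [NormedSpace ℝ X]
  [NormedAddCommGroup F] [NormedSpace ℝ F]

/-- Expansions are unique by linear independence, so the support condition passes to expansions
chosen beforehand. -/
lemma IsBlockSequence.successive {f : SchauderBasis ℝ F} {n : ℕ} {u : Fin n → F}
    (h : IsBlockSequence f u) {c : Fin n → ℕ →₀ ℝ}
    (hc : ∀ i, u i = Finsupp.linearCombination ℝ (f : ℕ → F) (c i)) :
    ∀ i j, i < j → ∀ p ∈ (c i).support, ∀ q ∈ (c j).support, p < q := by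
  obtain ⟨-, c', hc', hs⟩ := h
  have : c = c' := funext fun i => f.linearIndependent ((hc i).symm.trans (hc' i))
  exact this ▸ hs

/-- The approximation of a plegma block matrix in `F` by vectors of `X`: linear combinations of
the `f j` are replaced by combinations of entries, along a plegma family, of a matrix
that generates `f`. -/
lemma exists_approximation {k : ℕ} {ξ : Ordinal.{0}} {𝓑 : Set (Finset ℕ)}
    (hB : IsUniformBarrier ξ 𝓑) {f : SchauderBasis ℝ F} {x : ℕ → Finset ℕ → X}
    (hx : Generates 𝓑 x f) {M : Set ℕ} (hM : M.Infinite) {y : ℕ → Finset ℕ → F}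
    (hy : IsPlegmaBlock f (restrict (kSubsets k) M) y) :
    ∃ 𝓒, IsUniformBarrier (ξ + (k : Ordinal.{0})) 𝓒 ∧ ∃ v : ℕ → Finset ℕ → X,
      ∀ n m : ℕ, n < m → ∀ r : Fin n → Finset ℕ, (∀ i, r i ∈ above 𝓒 m) → IsPlegma r →
        ∃ t : Fin n → Finset ℕ, (∀ i, t i ∈ above (restrict (kSubsets k) M) m) ∧ IsPlegma t ∧
          ∀ a : Fin n → ℝ, (∀ i, a i ∈ Set.Icc (-1 : ℝ) 1) →
            |‖∑ i, a i • y i (t i)‖ - ‖∑ i, a i • v i (r i)‖| ≤ 1 / ((m : ℝ) + 1) ^ 2 := by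
  obtain ⟨ε, -, hε0, hε⟩ := hx
  obtain ⟨hyv, hyb⟩ := hy
  choose mb hmb using hyb
  obtain ⟨μ, hμ, hμM, hμb⟩ := exists_strictMono_mem_le hM mb
  have hc : ∀ i t, ∃ c : ℕ →₀ ℝ, t ∈ restrict (kSubsets k) M →
      y i t = Finsupp.linearCombination ℝ (f : ℕ → F) c := by
    intro i t
    by_cases ht : t ∈ restrict (kSubsets k) M
    · obtain ⟨-, c, hc⟩ := hyv i t ht
      exact ⟨c, fun _ => hc⟩
    · exact ⟨0, fun h => absurd h ht⟩
  choose c hc using hc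
  choose N K hK hNK using exists_bounds fun i t => c i (t.image μ)
  -- Beyond `g` the error of the generating matrix stays small after multiplication by the
  -- coefficient bound; `N A < g` because `Generates` admits only tuples shorter than the index.
  have hG : ∀ A : ℕ, ∃ g, N A < g ∧ K A * ε g ≤ 1 / ((A : ℝ) + 1) ^ 2 := by
    intro A
    have h1 : Tendsto (fun g => K A * ε g) atTop (𝓝 0) := by simpa using hε0.const_mul (K A)
    have h2 : (0 : ℝ) < 1 / ((A : ℝ) + 1) ^ 2 := by positivity
    obtain ⟨g, hg1, hg2⟩ := ((h1.eventually_le_const h2).and (eventually_gt_atTop (N A))).exists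
    exact ⟨g, hg2, hg1⟩
  choose G hNG hG using hG
  obtain ⟨h, hh, hhN, hhG⟩ := exists_strictMono_gap N G
  obtain ⟨l, hl, hlB⟩ := hB.exists_isMonotoneAlong
  -- The `b + 1` leaves room below the known member of `𝓑` for the shifts `h b + j`.
  have hφ : StrictMono fun b => l (h (b + 1)) := fun a b hab => hl (hh (Nat.succ_lt_succ hab))
  refine ⟨_, (hB.pullback hφ).prepend k, fun i r => (c i ((r.sort.take k).toFinset.image μ)).sum
    fun j q => q • x j (shifted 𝓑 l h j (r.sort.drop k)), fun n m hnm r hr hrp => ?_⟩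
  rw [isPlegma_iff] at hrp
  obtain ⟨-, hint⟩ := hrp
  have hsort := fun i => pairwise_sort_lt (r i)
  set T : Fin n → Finset ℕ := fun i => ((r i).sort.take k).toFinset with hT
  set U : Fin n → List ℕ := fun i => (r i).sort.drop k with hU
  have hTsort : ∀ i, ((r i).sort.take k).Pairwise (· < ·) := fun i => (hsort i).take
  have hkr : ∀ i, k ≤ (r i).card := fun i => (mem_prepend_iff.1 (hr i).1).1
  have hTeq : ∀ i, (T i).image μ = (((r i).sort.take k).map μ).toFinset := by
    intro i
    ext a
    simp only [hT, Finset.mem_image, List.mem_toFinset, List.mem_map]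
  have hTmem : ∀ i, ∀ a ∈ T i, m < a := fun i a ha => by
    simp only [hT, List.mem_toFinset] at ha
    exact (hr i).2 a ((Finset.mem_sort _).1 (List.mem_of_mem_take ha))
  have hTM : ∀ i, (T i).image μ ∈ restrict (kSubsets k) M := by
    refine fun i => ⟨?_, fun a ha => ?_⟩
    · change ((T i).image μ).card = k
      rw [Finset.card_image_of_injective _ hμ.injective, card_toFinset_of_pairwise (hTsort i)]
      simpa using hkr i
    · obtain ⟨b, -, rfl⟩ := Finset.mem_image.1 (Finset.mem_coe.1 ha)
      exact hμM b
  have hTp : IsPlegma fun i => (T i).image μ := by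
    simp only [hTeq]
    refine (isPlegma_toFinset_iff fun i => pairwise_map_of_strictMono hμ (hTsort i)).2
      ⟨fun i j _ => ?_, (hint.take k).map hμ⟩
    simp [hkr]
  have hTabove : ∀ m', m' ≤ μ m → ∀ i, (T i).image μ ∈ above (restrict (kSubsets k) M) m' := by
    refine fun m' hm' i => ⟨hTM i, fun a ha => ?_⟩
    obtain ⟨b, hb, rfl⟩ := Finset.mem_image.1 ha
    exact hm'.trans_lt (hμ (hTmem i b hb))
  refine ⟨fun i => (T i).image μ, hTabove m (hμ.id_le m), hTp, fun a ha => ?_⟩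
  rcases Nat.eq_zero_or_pos n with rfl | hn
  · simp only [Finset.univ_eq_empty, Finset.sum_empty, norm_zero, sub_zero, abs_zero]
    positivity
  -- As `n < m`, moving the heads by `μ` has pushed them past the threshold for block `n`-tuples.
  have hsucc := (hmb n _ (hTabove (mb n) (hμb n m hnm)) hTp).successive fun i => hc i _ (hTM i)
  obtain ⟨ι, hι, hιc⟩ := exists_monotone_index hn hsucc
  -- `A` separates the first `k` elements from the remaining ones
  set A := max m (Finset.univ.sup fun i => (T i).sup id) + 1 with hA
  have hTA : ∀ i, T i ⊆ Finset.range A := by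
    intro i b hb
    have h1 : b ≤ (T i).sup id := Finset.le_sup (f := id) hb
    have h2 : (T i).sup id ≤ Finset.univ.sup fun i => (T i).sup id :=
      Finset.le_sup (f := fun i => (T i).sup id) (Finset.mem_univ i)
    rw [Finset.mem_range, hA]
    exact Nat.lt_succ_of_le ((h1.trans h2).trans (le_max_right _ _))
  have hmA : m < A := Nat.lt_succ_of_le (le_max_left _ _)
  have hUA : ∀ i, ∀ b ∈ U i, A ≤ b := by
    intro i b hb
    rw [hA, Nat.succ_le_iff, max_lt_iff, Finset.sup_lt_iff]
    · have hmb : m < b := (hr i).2 b ((Finset.mem_sort _).1 (List.mem_of_mem_drop hb))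
      refine ⟨hmb, fun j _ => (Finset.sup_lt_iff (hmb.bot_lt)).2 fun d hd => ?_⟩
      exact hint.lt_of_mem_take_of_mem_drop hsort (List.mem_toFinset.1 hd) hb
    · exact ((hr i).2 b ((Finset.mem_sort _).1 (List.mem_of_mem_drop hb))).bot_lt
  have hbd := fun i : Fin n => hNK A i (i.2.trans (hnm.trans hmA)) (T i) (hTA i)
  have hUB : ∀ i, (((U i).map fun b => h (b + 1)).map l).toFinset ∈ 𝓑 := by
    intro i
    have h1 := (mem_prepend_iff.1 (hr i).1).2
    rw [pullback, Set.mem_ofPred_eq] at h1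
    convert h1 using 1
    ext b
    simp only [hU, List.map_map, Finset.mem_image, List.mem_toFinset, List.mem_map,
      Function.comp_apply]
  have hUs : ∀ i, (U i).Pairwise (· < ·) := fun i => (hsort i).drop
  have hUN : ∀ i, ∀ b ∈ U i, h b + N A ≤ h (b + 1) := fun i b hb => hhN A b (hUA i b hb)
  have hwp : IsPlegma fun j : Fin (N A) => shifted 𝓑 l h j (U (ι j)) :=
    isPlegma_shifted hB.1 hlB hl hh hUs (hint.drop k) hUN hUB (ι := fun j => ι j)
      fun i j hij => hι hij
  have hwabove : ∀ j : Fin (N A), shifted 𝓑 l h j (U (ι j)) ∈ above 𝓑 (G A) := by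
    intro j
    obtain ⟨p, hp, hpB⟩ := shifted_spec hlB hh (hUs (ι j))
      (fun b hb => (Nat.add_lt_add_left j.2 _).trans_le (hUN _ b hb)) (hUB (ι j))
    refine ⟨hpB, fun d hd => ?_⟩
    rw [hp] at hd
    simp only [List.mem_toFinset, List.mem_map] at hd
    obtain ⟨_, ⟨b, hb, rfl⟩, rfl⟩ := hd
    have h1 := hhG A (by omega)
    have h2 := hh.monotone (hUA _ b (List.mem_of_mem_take hb))
    have h3 := hl.id_le (h b + j)
    simp only [id] at h3
    omega
  have hsumF : ∑ i, a i • y i ((T i).image μ) = ∑ j : Fin (N A),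
      (a (ι j) * c (ι j) ((T (ι j)).image μ) j) • f j := by
    rw [← sum_smul_finsuppSum_eq (c := fun i => c i ((T i).image μ)) hιc
      (fun i j => ((hbd i j).2)) a fun _ j => f j]
    refine Finset.sum_congr rfl fun i _ => ?_
    rw [hc i _ (hTM i), Finsupp.linearCombination_apply]
  have hsumX := sum_smul_finsuppSum_eq (c := fun i => c i ((T i).image μ)) hιc
    (fun i j => ((hbd i j).2)) a fun i j => x j (shifted 𝓑 l h j (U i))
  rw [hsumF]
  refine le_trans ?_ ((hG A).trans ?_)
  · refine (le_of_eq ?_).trans (abs_norm_sum_sub_norm_sum_le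
      (hε (N A) (G A) (hNG A) _ hwabove hwp) (hK A)
      (b := fun j => a (ι j) * c (ι j) ((T (ι j)).image μ) j) fun j => ?_)
    · rw [← hsumX]
    · rw [abs_mul]
      exact (mul_le_mul (abs_le.2 (ha _)) (hbd (ι j) j).1 (abs_nonneg _) zero_le_one).trans_eq
        (one_mul _)
  · have : (m : ℝ) ≤ A := by exact_mod_cast hmA.le
    gcongr

end Main

end PlegmaModels

namespace PlegmaModels

/-! ### Passing to unit vectors. -/

section Normalization

variable {X F E : Type*} [NormedAddCommGroup X] [NormedSpace ℝ X]
  [NormedAddCommGroup F] [NormedSpace ℝ F]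

open Classical in
/-- The vector `v` scaled to norm one, and the unit vector `w` if `v = 0`. -/
noncomputable def normalized (w v : X) : X :=
  if v = 0 then w else ‖v‖⁻¹ • v

lemma norm_normalized {w : X} (hw : ‖w‖ = 1) (v : X) : ‖normalized w v‖ = 1 := by
  unfold normalized
  split_ifs with h
  · exact hw
  · rw [norm_smul, norm_inv, norm_norm, inv_mul_cancel₀ (norm_ne_zero_iff.2 h)]

lemma norm_sub_normalized_le {w v : X} {δ : ℝ} (hδ : δ < 1) (h : |1 - ‖v‖| ≤ δ) :
    ‖v - normalized w v‖ ≤ δ := by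
  have hv : v ≠ 0 := by
    rintro rfl
    rw [norm_zero, sub_zero, abs_one] at h
    linarith
  rw [normalized, if_neg hv, norm_sub_inv_norm_smul hv, abs_sub_comm]
  exact h

/-- Testing on coordinate vectors shows that each `‖v i‖` is within `δ` of `1`. Normalization then
moves each of the `n` terms by at most `δ`, on top of the original error. -/
lemma abs_norm_sum_sub_norm_sum_normalized_le {n : ℕ} {y : Fin n → F} {v : Fin n → X} {δ : ℝ}
    (hδ : δ < 1) (hy : ∀ i, ‖y i‖ = 1)
    (h : ∀ a : Fin n → ℝ, (∀ i, a i ∈ Set.Icc (-1 : ℝ) 1) →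
      |‖∑ i, a i • y i‖ - ‖∑ i, a i • v i‖| ≤ δ) (w : X) {a : Fin n → ℝ}
    (ha : ∀ i, a i ∈ Set.Icc (-1 : ℝ) 1) :
    |‖∑ i, a i • y i‖ - ‖∑ i, a i • normalized w (v i)‖| ≤ (n + 1) * δ := by
  have hv : ∀ i, ‖v i - normalized w (v i)‖ ≤ δ := by
    intro i
    refine norm_sub_normalized_le hδ ?_
    have h1 := h (Pi.single i 1) fun j => by
      by_cases hj : j = i
      · subst hj; simp
      · simp [hj]
    simpa [Pi.single_apply, ite_smul, hy i] using h1
  have h2 : ‖∑ i, a i • v i - ∑ i, a i • normalized w (v i)‖ ≤ n * δ := by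
    rw [← Finset.sum_sub_distrib]
    refine (norm_sum_le_of_le _ (f := fun i => a i • v i - a i • normalized w (v i))
      (n := fun _ => δ) fun i _ => ?_).trans_eq (by simp)
    rw [← smul_sub, norm_smul, Real.norm_eq_abs]
    exact (mul_le_mul (abs_le.2 (ha i)) (hv i) (norm_nonneg _) zero_le_one).trans_eq (one_mul _)
  have h3 := (abs_norm_sub_norm_le (∑ i, a i • v i) (∑ i, a i • normalized w (v i))).trans h2
  have h4 := abs_sub_le (‖∑ i, a i • y i‖) (‖∑ i, a i • v i‖) (‖∑ i, a i • normalized w (v i)‖)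
  linarith [h a ha]

end Normalization

end PlegmaModels

theorem mainTheorem3
    {X F E : Type*}
    [NormedAddCommGroup X] [NormedSpace ℝ X] [CompleteSpace X]
    [NormedAddCommGroup F] [NormedSpace ℝ F] [CompleteSpace F]
    [NormedAddCommGroup E] [NormedSpace ℝ E] [CompleteSpace E]
    (k : ℕ) (hk : 1 ≤ k) (ξ : Ordinal.{0}) (hξ : ξ < Ordinal.omega 1)
    (f : SchauderBasis ℝ F) (hf : f ∈ PlegmaModels.AM X F ξ)
    (M : Set ℕ) (hM : M.Infinite)
    (y : ℕ → Finset ℕ → F)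
    (hy : PlegmaModels.IsPlegmaBlock f
      (PlegmaModels.restrict (PlegmaModels.kSubsets k) M) y)
    (e : SchauderBasis ℝ E)
    (he : PlegmaModels.IsAsymptoticModelOf
      (PlegmaModels.restrict (PlegmaModels.kSubsets k) M) y e) :
    e ∈ PlegmaModels.AM X E (ξ + (k : Ordinal.{0})) := by
  obtain ⟨𝓑, hB, x, hx, -, hgen⟩ := hf
  obtain ⟨hym, he1, ε, hε, hε0, hye⟩ := he
  -- Supplies a unit vector of `X`, the substitute for entries at which the approximating vector
  -- vanishes.
  obtain ⟨s, hs⟩ := hB.2.nonempty Set.infinite_univ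
  obtain ⟨𝓒, hC, v, hv⟩ := PlegmaModels.exists_approximation hB hgen hM hy
  refine ⟨𝓒, hC, fun i r => PlegmaModels.normalized (x 0 s) (v i r),
    fun i r _ => PlegmaModels.norm_normalized (hx 0 s hs) _, he1,
    -- Normalization multiplies the error `1 / (m + 1) ^ 2` by `n + 1 ≤ m`, which leaves at most `1
    -- / (m + 1)`.
    fun m => ε m + 1 / ((m : ℝ) + 1), ?_, ?_, ?_⟩
  · exact hε.add fun m n hmn => Nat.one_div_le_one_div hmn
  · simpa using hε0.add tendsto_one_div_add_atTop_nhds_zero_nat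
  · intro n m hnm r hr hrp a ha
    obtain ⟨t, ht, htp, hta⟩ := hv n m hnm r hr hrp
    have hnm' : (n : ℝ) + 1 ≤ m := by exact_mod_cast hnm
    have hn0 : (0 : ℝ) ≤ n := Nat.cast_nonneg n
    have h1 := hye n m hnm t ht htp a ha
    have h2 := PlegmaModels.abs_norm_sum_sub_norm_sum_normalized_le
      (by rw [div_lt_one (by positivity)]; nlinarith) (fun i => hym i (t i) (ht i).1) hta
      (x 0 s) ha
    have h3 : ((n : ℝ) + 1) * (1 / ((m : ℝ) + 1) ^ 2) ≤ 1 / ((m : ℝ) + 1) := by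
      rw [mul_one_div, div_le_div_iff₀ (by positivity) (by positivity)]
      nlinarith
    have h4 := abs_sub_le (‖∑ i, a i • e i‖) (‖∑ i, a i • y i (t i)‖)
      (‖∑ i, a i • PlegmaModels.normalized (x 0 s) (v i (r i))‖)
    exact h4.trans_lt (add_lt_add_of_lt_of_le h1 (h2.trans h3))
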